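/- Let $\mathbb{F}_2^{n,w}$ (where $2w\le n$) be the binary Johnson space, i.e. the set of vectors in $\mathbb{F}_2^n$ with exactly $w$ ones, with the distance $\tau(x,y)=|\{i : x_i\neq y_i\}|/2$. A finite set $X\subset \mathbb{F}_2^{n,w}$ is an $s$-distance set if $|\{\tau(x,y) : x,y\in X,\ x\neq y\}|=s$, and $A(\mathbb{F}_2^{n,w},s)$ denotes the maximum cardinality of an $s$-distance set in $\mathbb{F}_2^{n,w}$. Then $$A(\mathbb{F}_2^{24,8},2)=253.$$ Moreover, let $\mathcal{G}_{23}$ be the binary Golay code of length $23$, i.e. the cyclic code in $\mathbb{F}_2^{23}$ generated by the polynomial $1+x+x^5+x^6+x^7+x^9+x^{11}$, and let $X$ be the set of its words of weight $7$. Then $|X|=253$, and $Y=\{(1,u) : u\in X\}$ is a two-distance set in $\mathbb{F}_2^{24,8}$ with $|Y|=253$, so $Y$ attains this maximum. -/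

import Mathlib

/-- The set `D(X)` of the values taken by `τ` at pairs of distinct points of `X`. -/
def distanceSet {M : Type*} (τ : M → M → ℝ) (X : Set M) : Set ℝ :=
  {d | ∃ x ∈ X, ∃ y ∈ X, x ≠ y ∧ τ x y = d}

/-- A finite set is an `s`-distance set if exactly `s` distances occur between distinct points. -/
def IsSDistanceSet {M : Type*} (τ : M → M → ℝ) (s : ℕ) (X : Set M) : Prop :=
  X.Finite ∧ (distanceSet τ X).ncard = s

/-- `N` is the maximum cardinality `A(M, s)` of an `s`-distance set in `(M, τ)`: it is attained
and it is an upper bound. -/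
def IsMaxSDistanceCard {M : Type*} (τ : M → M → ℝ) (s N : ℕ) : Prop :=
  IsGreatest {k : ℕ | ∃ X : Set M, IsSDistanceSet τ s X ∧ X.ncard = k} N

/-- The binary Johnson space: binary vectors of length `n` with exactly `w` ones. -/
def JohnsonSpace (n w : ℕ) : Type :=
  {x : Fin n → ZMod 2 // hammingNorm x = w}

/-- The Johnson distance: half the number of coordinates in which two vectors differ. -/
noncomputable def johnsonDist {n w : ℕ} (x y : JohnsonSpace n w) : ℝ :=
  (hammingDist x.1 y.1 : ℝ) / 2

theorem hammingNorm_cons_one {n : ℕ} (u : Fin n → ZMod 2) :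
    hammingNorm (Fin.cons 1 u : Fin (n + 1) → ZMod 2) = hammingNorm u + 1 := by
  simp only [hammingNorm, Finset.card_filter]
  rw [Fin.sum_univ_succ]
  simp [add_comm]

/-- The map `u ↦ (1, u)`. -/
def prependOne {n w : ℕ} (u : JohnsonSpace n w) : JohnsonSpace (n + 1) (w + 1) :=
  ⟨Fin.cons 1 u.1, by rw [hammingNorm_cons_one, u.2]⟩

/-- The coefficient vector of `1 + X + X^5 + X^6 + X^7 + X^9 + X^11`, one of the two irreducible
factors of degree `11` of `X^23 - 1` over the field with two elements. -/
def golayGenerator : Fin 23 → ZMod 2 :=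
  ![1, 1, 0, 0, 0, 1, 1, 1, 0, 1, 0, 1, 0, 0, 0, 0, 0, 0, 0, 0, 0, 0, 0]

/-- The binary Golay code of length `23`, as the cyclic code generated by `golayGenerator`: the
linear span of all cyclic shifts of that vector. -/
def golayCode : Submodule (ZMod 2) (Fin 23 → ZMod 2) :=
  Submodule.span (ZMod 2) (Set.range fun j : Fin 23 => fun i : Fin 23 => golayGenerator (i - j))

/-- The words of weight `7` of the Golay code. -/
def golayWordsOfWeightSeven : Set (JohnsonSpace 23 7) :=
  {u | u.1 ∈ golayCode}

/-! Supports turn a two-distance set in the Johnson space into a family of 8-subsets of 24 points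
with two intersection numbers l₁ < l₂ < 8. If l₁ ≤ 1, Fisher's inequality bounds the blocks through
an (l₁ + 1)-set by 24, and double counting finishes. If l₁ + l₂ ≥ 6, the linear-algebra bound
`card_add_card_le_of_two_inter` gives C(24,2) - 24 + 1 = 253. The one remaining pair (2, 3) is a
packing of 4-sets.

Equality comes from the Golay code. Its 4096 words are listed as bit masks and their weights
computed; two distinct words of weight 7 then differ in 8 or 12 places. -/

section BlockFamilies

open Finset

/-! ### Bounds for set families with few intersection numbers. -/

variable {α : Type*} [Fintype α] [DecidableEq α]

theorem sum_indicator_mul_indicator (x y : Finset α) :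
    ∑ p, (if p ∈ x then (1 : ℝ) else 0) * (if p ∈ y then 1 else 0) = #(x ∩ y) := by
  simp only [← ite_and, mul_ite, mul_one, mul_zero]
  rw [← Finset.sum_filter]
  simp only [sum_const, nsmul_eq_mul, mul_one, Nat.cast_inj]
  congr 1
  ext p
  simp [and_comm]

/-- Fisher's inequality for families of `k`-sets meeting pairwise in `l < k` points. -/
theorem card_le_of_constant_inter {k l : ℕ} (hl : l < k) (B : Finset (Finset α))
    (hk : ∀ x ∈ B, #x = k) (hB : ∀ x ∈ B, ∀ y ∈ B, x ≠ y → #(x ∩ y) = l) :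
    #B ≤ Fintype.card α := by
  let f : (B → ℝ) →ₗ[ℝ] (α → ℝ) :=
    { toFun := fun c p => ∑ x : B, c x * (if p ∈ x.1 then (1 : ℝ) else 0)
      map_add' := by
        intro c d; ext p; simp only [Pi.add_apply, add_mul, sum_add_distrib]
      map_smul' := by
        intro r c; ext p
        simp only [Pi.smul_apply, smul_eq_mul, mul_assoc, mul_sum, RingHom.id_apply] }
  have hf : Function.Injective f := by
    rw [← LinearMap.ker_eq_bot, LinearMap.ker_eq_bot']
    intro c hc
    -- Pairing with the indicator of y applies the Gram matrix (k - l)I + lJ, which is positive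
    -- definite.
    have key : ∀ y : B, (k - l : ℝ) * c y + l * ∑ x, c x = 0 := by
      intro y
      have h1 : ∑ p, f c p * (if p ∈ y.1 then (1 : ℝ) else 0) = 0 := by simp [hc]
      have h2 : ∑ p, f c p * (if p ∈ y.1 then (1 : ℝ) else 0)
          = ∑ x : B, c x * (#(x.1 ∩ y.1) : ℝ) := by
        simp only [f, LinearMap.coe_mk, AddHom.coe_mk, sum_mul]
        rw [sum_comm]
        refine sum_congr rfl fun x _ => ?_
        rw [← sum_indicator_mul_indicator, mul_sum]
        exact sum_congr rfl fun p _ => by ring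
      have h3 : ∀ x : B, c x * (#(x.1 ∩ y.1) : ℝ)
          = l * c x + (if x = y then (k - l : ℝ) * c y else 0) := by
        intro x
        split_ifs with h
        · subst h; rw [inter_self, hk _ x.2]; ring
        · rw [hB _ x.2 _ y.2 (fun h' => h (Subtype.ext h'))]; ring
      rw [h2, sum_congr rfl fun x _ => h3 x, sum_add_distrib, ← mul_sum] at h1
      simp only [sum_ite_eq', mem_univ, if_true] at h1
      linarith
    have hkl : (0 : ℝ) < k - l := by
      have : (l : ℝ) < k := by exact_mod_cast hl
      linarith
    have h4 : (k - l : ℝ) * ∑ y, c y ^ 2 + l * (∑ x, c x) ^ 2 = 0 := by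
      have : ∑ y, c y * ((k - l : ℝ) * c y + l * ∑ x, c x) = 0 :=
        sum_eq_zero fun y _ => by rw [key y, mul_zero]
      rw [← this, mul_sum, sq (∑ x, c x), ← mul_assoc, mul_comm ((l : ℝ) * _), sum_mul,
        ← sum_add_distrib]
      exact sum_congr rfl fun y _ => by ring
    have h5 : ∑ y, c y ^ 2 = 0 := by
      have a1 : 0 ≤ ∑ y, c y ^ 2 := sum_nonneg fun y _ => sq_nonneg _
      have a2 : 0 ≤ (l : ℝ) * (∑ x, c x) ^ 2 := by positivity
      nlinarith
    ext y
    have := (sum_eq_zero_iff_of_nonneg fun y _ => sq_nonneg (c y)).1 h5 y (mem_univ y)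
    simpa using this
  simpa using LinearMap.finrank_le_finrank_of_injective hf

/-- Double counting of incidences between blocks and `t`-sets. -/
theorem card_mul_choose_le {k t N : ℕ} (B : Finset (Finset α)) (hk : ∀ x ∈ B, #x = k)
    (hN : ∀ s : Finset α, #s = t → #{x ∈ B | s ⊆ x} ≤ N) :
    #B * k.choose t ≤ (Fintype.card α).choose t * N := by
  rw [← Finset.card_univ, ← card_powersetCard]
  refine card_mul_le_card_mul (fun x s => s ⊆ x) (fun x hx => ?_) (fun s hs => ?_)
  · rw [← hk x hx, ← card_powersetCard]
    refine card_le_card fun s hs => ?_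
    simp only [mem_powersetCard, bipartiteAbove, mem_filter, subset_univ, true_and] at hs ⊢
    exact ⟨hs.2, hs.1⟩
  · exact hN s (mem_powersetCard.1 hs).2

/-- A packing bound: if `k`-sets meet pairwise in fewer than `t` points, each `t`-set lies in at
most one of them. -/
theorem card_mul_choose_le_of_inter_lt {k t : ℕ} (B : Finset (Finset α)) (hk : ∀ x ∈ B, #x = k)
    (hB : ∀ x ∈ B, ∀ y ∈ B, x ≠ y → #(x ∩ y) < t) :
    #B * k.choose t ≤ (Fintype.card α).choose t := by
  refine (card_mul_choose_le (N := 1) B hk fun s hs => ?_).trans_eq (mul_one _)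
  rw [card_le_one]
  intro x hx y hy
  rw [mem_filter] at hx hy
  by_contra hne
  have := card_le_card (subset_inter hx.2 hy.2)
  have := hB x hx.1 y hy.1 hne
  omega

/-- If `k`-sets meet pairwise in `l₁` or `l₂` points, those through a given
`(l₁ + 1)`-set satisfy Fisher's inequality. -/
theorem card_mul_choose_le_of_two_inter {k l₁ l₂ : ℕ} (h₂ : l₂ < k)
    (B : Finset (Finset α)) (hk : ∀ x ∈ B, #x = k)
    (hB : ∀ x ∈ B, ∀ y ∈ B, x ≠ y → #(x ∩ y) = l₁ ∨ #(x ∩ y) = l₂) :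
    #B * k.choose (l₁ + 1) ≤ (Fintype.card α).choose (l₁ + 1) * Fintype.card α := by
  -- Two blocks through s share at least l₁ + 1 points, so they meet in exactly l₂.
  refine card_mul_choose_le B hk fun s hs => card_le_of_constant_inter h₂ _ ?_ ?_
  · exact fun x hx => hk x (mem_filter.1 hx).1
  · intro x hx y hy hne
    rw [mem_filter] at hx hy
    have := card_le_card (subset_inter hx.2 hy.2)
    have := hB x hx.1 y hy.1 hne
    omega

/-- The harmonic absolute bound for two intersection numbers whose sum is large: the degree-one
harmonics do not contribute. -/
theorem card_add_card_le_of_two_inter {k l₁ l₂ : ℕ} (hn : 3 ≤ Fintype.card α)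
    (h₁ : l₁ < k) (h₂ : l₂ < k)
    (hsum : 2 * ((k : ℝ) - 1) ^ 2 ≤ ((Fintype.card α : ℝ) - 2) * ((l₁ : ℝ) + l₂ - 1))
    (B : Finset (Finset α)) (hk : ∀ x ∈ B, #x = k)
    (hB : ∀ x ∈ B, ∀ y ∈ B, x ≠ y → #(x ∩ y) = l₁ ∨ #(x ∩ y) = l₂) :
    #B + Fintype.card α ≤ (Fintype.card α).choose 2 + 1 := by
  set n := Fintype.card α with hn_def
  have hn' : (3 : ℝ) ≤ n := by exact_mod_cast hn
  let e : Finset α → α → ℝ := fun x p => if p ∈ x then 1 else 0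
  have he : ∀ x p, e x p * e x p = e x p := fun x p => by simp [e]
  have hee : ∀ x y, ∑ p, e x p * e y p = #(x ∩ y) := sum_indicator_mul_indicator
  have hek : ∀ x : B, ∑ p, e x p = k := by
    intro x
    have := hee x x
    simpa only [he, inter_self, hk x.1 x.2] using this
  -- Injectivity makes the pair-indicators of the blocks, tagged by the coefficient sum, independent
  -- together with the n point functions; hence n is subtracted from the bound.
  let f : ((B → ℝ) × (α → ℝ)) →ₗ[ℝ] (({s : Finset α // #s = 2} → ℝ) × ℝ) :=
    { toFun := fun cv =>
        (fun s => ∑ x : B, cv.1 x * ∏ p ∈ s.1, e x p + ∑ p ∈ s.1, cv.2 p, ∑ x, cv.1 x)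
      map_add' := by
        intro c d
        refine Prod.ext ?_ ?_
        · ext s; simp only [Prod.fst_add, Prod.snd_add, Pi.add_apply, add_mul, sum_add_distrib]
          ring
        · simp only [Prod.fst_add, Prod.snd_add, Pi.add_apply, sum_add_distrib]
      map_smul' := by
        intro r c
        refine Prod.ext ?_ ?_
        · ext s
          simp only [Prod.smul_fst, Prod.smul_snd, Pi.smul_apply, smul_eq_mul, mul_assoc,
            mul_sum, RingHom.id_apply, mul_add]
        · simp only [Prod.smul_fst, Prod.smul_snd, Pi.smul_apply, smul_eq_mul, mul_sum,
            RingHom.id_apply] }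
  have hf : Function.Injective f := by
    rw [← LinearMap.ker_eq_bot, LinearMap.ker_eq_bot']
    rintro ⟨c, v⟩ hcv
    have hc : ∑ x, c x = 0 := congrArg Prod.snd hcv
    have hpq : ∀ p q, p ≠ q → ∑ x : B, c x * (e x p * e x q) + (v p + v q) = 0 := by
      intro p q hne
      have : (f (c, v)).1 ⟨{p, q}, card_pair hne⟩ = 0 := by rw [hcv]; rfl
      simpa only [f, LinearMap.coe_mk, AddHom.coe_mk, prod_pair hne, sum_pair hne] using this
    let u : α → ℝ := fun p => ∑ x : B, c x * e x p
    let a : α → α → ℝ := fun p q => ∑ x : B, c x * (e x p * e x q) + (v p + v q)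
    -- The kernel condition kills only off-diagonal entries; the diagonal is computed from e² = e.
    have ha : ∀ p q, a p q = if p = q then u p + 2 * v p else 0 := by
      intro p q
      split_ifs with h
      · subst h; simp only [a, he, u]; ring
      · exact hpq p q h
    have hu : ∑ p, u p = 0 := by
      simp only [u]
      rw [sum_comm]
      simp only [← mul_sum, hek, ← sum_mul, hc, zero_mul]
    -- Row sums of a; once `hV` holds, v is the multiple -(k - 1)/(n - 2) of u.
    have hrow : ∀ p, (k - 1 : ℝ) * u p + (n - 2) * v p + ∑ q, v q = 0 := by
      intro p
      have h1 : ∑ q, a p q = u p + 2 * v p := by simp [ha]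
      have h2 : ∑ q, a p q = k * u p + (n * v p + ∑ q, v q) := by
        simp only [a, sum_add_distrib, sum_const, card_univ, nsmul_eq_mul, ← hn_def]
        rw [sum_comm]
        simp only [← mul_sum, hek, u]
        congr 1
        rw [mul_sum]
        exact sum_congr rfl fun x _ => by ring
      linarith
    have hV : ∑ q, v q = 0 := by
      have : ∑ p, ((k - 1 : ℝ) * u p + (n - 2) * v p + ∑ q, v q) = 0 :=
        sum_eq_zero fun p _ => hrow p
      simp only [sum_add_distrib, ← mul_sum, hu, sum_const, card_univ, nsmul_eq_mul,
        ← hn_def] at this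
      have h0 : (2 * (n - 1) : ℝ) * ∑ q, v q = 0 := by linarith
      rcases mul_eq_zero.1 h0 with h | h
      · linarith
      · exact h
    have hz : ∀ y : B, ∑ x : B, c x * (#(x.1 ∩ y.1) : ℝ) = ∑ p, u p * e y p := by
      intro y
      simp only [u, sum_mul]
      rw [sum_comm]
      refine sum_congr rfl fun x _ => ?_
      rw [← hee, mul_sum]
      exact sum_congr rfl fun p _ => by ring
    have hzw : ∀ y : B, (k - 1 : ℝ) * ∑ p, u p * e y p + (n - 2) * ∑ p, v p * e y p = 0 := by
      intro y
      rw [mul_sum, mul_sum, ← sum_add_distrib]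
      refine sum_eq_zero fun p _ => ?_
      have := hrow p
      rw [hV] at this
      linear_combination e y p * this
    -- The quadratic form a evaluated at the indicator of y in two ways.
    have hquad : ∀ y : B, ∑ x : B, c x * (#(x.1 ∩ y.1) : ℝ) ^ 2 + 2 * k * ∑ p, v p * e y p
        = ∑ p, u p * e y p + 2 * ∑ p, v p * e y p := by
      intro y
      have h1 : ∑ p, ∑ q, e y p * e y q * a p q
          = ∑ p, u p * e y p + 2 * ∑ p, v p * e y p := by
        simp only [ha, mul_ite, mul_zero, sum_ite_eq, mem_univ, if_true, he]
        rw [mul_sum, ← sum_add_distrib]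
        exact sum_congr rfl fun p _ => by ring
      have h2 : ∑ p, ∑ q, e y p * e y q * ∑ x : B, c x * (e x p * e x q)
          = ∑ x : B, c x * (#(x.1 ∩ y.1) : ℝ) ^ 2 := by
        simp only [mul_sum]
        simp only [sum_comm (t := (univ : Finset B))]
        refine sum_congr rfl fun x _ => ?_
        rw [← hee, sq, sum_mul_sum, mul_sum]
        refine sum_congr rfl fun p _ => ?_
        rw [mul_sum]
        exact sum_congr rfl fun q _ => by ring
      have h3 : ∑ p, ∑ q, e y p * e y q * v p = k * ∑ p, v p * e y p := by
        rw [mul_sum]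
        refine sum_congr rfl fun p _ => ?_
        rw [← hek y, sum_mul]
        exact sum_congr rfl fun q _ => by ring
      have h4 : ∑ p, ∑ q, e y p * e y q * v q = k * ∑ p, v p * e y p := by
        rw [← h3, sum_comm]
        exact sum_congr rfl fun p _ => sum_congr rfl fun q _ => by ring
      rw [← h1]
      simp only [a, mul_add, sum_add_distrib]
      rw [h2, h3, h4]
      ring
    -- The polynomial (t - l₁)(t - l₂) vanishes at every intersection size except t = k.
    have hμ : ∀ y : B, ∑ x : B, c x * (((#(x.1 ∩ y.1) : ℝ) - l₁) * (#(x.1 ∩ y.1) - l₂))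
        = (k - l₁) * (k - l₂) * c y := by
      intro y
      rw [sum_eq_single y]
      · rw [inter_self, hk _ y.2]; ring
      · intro x _ hxy
        rcases hB _ x.2 _ y.2 (fun h => hxy (Subtype.ext h)) with h | h <;> rw [h] <;> ring
      · exact fun h => absurd (mem_univ y) h
    have hexp : ∀ y : B, ∑ x : B, c x * (((#(x.1 ∩ y.1) : ℝ) - l₁) * (#(x.1 ∩ y.1) - l₂))
        = ∑ x : B, c x * (#(x.1 ∩ y.1) : ℝ) ^ 2 - (l₁ + l₂) * ∑ p, u p * e y p := by
      intro y
      rw [← hz y, ← sub_eq_zero, mul_sum, ← sum_sub_distrib, ← sum_sub_distrib]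
      have : (l₁ * l₂ : ℝ) * ∑ x, c x = 0 := by rw [hc, mul_zero]
      rw [← this, mul_sum]
      exact sum_congr rfl fun x _ => by ring
    have hlin : ∀ y : B, (n - 2 : ℝ) * ((k - l₁) * (k - l₂)) * c y
        + ((n - 2) * ((l₁ : ℝ) + l₂ - 1) - 2 * (k - 1) ^ 2) * ∑ p, u p * e y p = 0 := by
      intro y
      linear_combination (n - 2 : ℝ) * hexp y - (n - 2 : ℝ) * hμ y
        + (n - 2 : ℝ) * hquad y - 2 * (k - 1) * hzw y
    have hnorm : ∑ y : B, c y * ∑ p, u p * e y p = ∑ p, u p ^ 2 := by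
      simp only [mul_sum]
      rw [sum_comm]
      refine sum_congr rfl fun p _ => ?_
      rw [sq]
      nth_rewrite 3 [show u p = ∑ x : B, c x * e x p from rfl]
      rw [mul_sum]
      exact sum_congr rfl fun y _ => by ring
    -- Both terms are nonnegative: `hsum` is exactly the sign condition on the coefficient of ∑ u².
    have htot : (n - 2 : ℝ) * ((k - l₁) * (k - l₂)) * ∑ y, c y ^ 2
        + ((n - 2) * ((l₁ : ℝ) + l₂ - 1) - 2 * (k - 1) ^ 2) * ∑ p, u p ^ 2 = 0 := by
      rw [← hnorm, mul_sum, mul_sum, ← sum_add_distrib]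
      refine sum_eq_zero fun y _ => ?_
      linear_combination c y * hlin y
    have hpos : (0 : ℝ) < (n - 2) * ((k - l₁) * (k - l₂)) := by
      have a1 : (l₁ : ℝ) < k := by exact_mod_cast h₁
      have a2 : (l₂ : ℝ) < k := by exact_mod_cast h₂
      exact mul_pos (by linarith) (mul_pos (by linarith) (by linarith))
    have hsq : ∑ y, c y ^ 2 = 0 := by
      have b1 : 0 ≤ ∑ y, c y ^ 2 := sum_nonneg fun y _ => sq_nonneg _
      have b2 : 0 ≤ ((n - 2) * ((l₁ : ℝ) + l₂ - 1) - 2 * (k - 1) ^ 2) * ∑ p, u p ^ 2 :=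
        mul_nonneg (by linarith) (sum_nonneg fun p _ => sq_nonneg _)
      nlinarith
    have hc0 : c = 0 := by
      ext y
      have := (sum_eq_zero_iff_of_nonneg fun y _ => sq_nonneg (c y)).1 hsq y (mem_univ y)
      simpa using this
    have hv0 : v = 0 := by
      ext p
      have := hrow p
      have hup : u p = 0 := by simp [u, hc0]
      rw [hV, hup, mul_zero, zero_add, add_zero] at this
      rcases mul_eq_zero.1 this with h | h
      · linarith
      · exact h
    rw [hc0, hv0]; rfl
  have := LinearMap.finrank_le_finrank_of_injective hf
  simpa [Module.finrank_prod, Fintype.card_finset_len, ← hn_def] using this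

/-- Families of `8`-subsets of a `24`-set with two intersection numbers. -/
theorem card_le_of_two_inter_eight (hα : Fintype.card α = 24) {l₁ l₂ : ℕ} (h₁₂ : l₁ < l₂)
    (h₂ : l₂ < 8) (B : Finset (Finset α)) (hk : ∀ x ∈ B, #x = 8)
    (hB : ∀ x ∈ B, ∀ y ∈ B, x ≠ y → #(x ∩ y) = l₁ ∨ #(x ∩ y) = l₂) : #B ≤ 253 := by
  by_cases hl : l₁ ≤ 1
  -- The bounds are 72 for l₁ = 0 and 236 for l₁ = 1.
  · have := card_mul_choose_le_of_two_inter h₂ B hk hB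
    rw [hα] at this
    interval_cases l₁ <;> norm_num [Nat.choose] at this <;> omega
  by_cases hs : 6 ≤ l₁ + l₂
  · have hs' : (6 : ℝ) ≤ (l₁ : ℝ) + l₂ := by exact_mod_cast hs
    -- The sign condition reads 2 · 7² = 98 ≤ 22 · 5 = 110.
    have := card_add_card_le_of_two_inter (by omega) (h₁₂.trans h₂) h₂
      (by rw [hα]; push_cast; linarith) B hk hB
    rw [hα] at this
    norm_num [Nat.choose] at this
    omega
  -- Only l₁ = 2, l₂ = 3 is left; the bound is 10626 / 70 < 152.
  · have := card_mul_choose_le_of_inter_lt (t := 4) B hk fun x hx y hy hne => by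
      have := hB x hx y hy hne
      omega
    rw [hα] at this
    norm_num [Nat.choose] at this
    omega

end BlockFamilies

/-! ### Binary linear algebra on bit masks. -/

/-- The binary vector of length `23` whose coordinates are the binary digits of `n`. -/
def bitVector (n : ℕ) : Fin 23 → ZMod 2 := fun i => if n.testBit i then 1 else 0

theorem bitVector_zero : bitVector 0 = 0 := by
  ext i; simp [bitVector]

theorem bitVector_xor (a b : ℕ) : bitVector (a ^^^ b) = bitVector a + bitVector b := by
  ext i
  simp only [bitVector, Nat.testBit_xor, Pi.add_apply]
  cases a.testBit i <;> cases b.testBit i <;> rfl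

theorem bitVector_injOn : Set.InjOn bitVector {n | n < 2 ^ 23} := by
  intro a ha b hb h
  refine Nat.eq_of_testBit_eq fun i => ?_
  by_cases hi : i < 23
  · have := congrFun h ⟨i, hi⟩
    simp only [bitVector] at this
    cases h1 : a.testBit i <;> cases h2 : b.testBit i <;> simp_all
  · have hp : 2 ^ 23 ≤ 2 ^ i := Nat.pow_le_pow_right (by norm_num) (by omega)
    rw [Nat.testBit_lt_two_pow (lt_of_lt_of_le ha hp),
      Nat.testBit_lt_two_pow (lt_of_lt_of_le hb hp)]

/-- The number of ones among the lowest `k` binary digits of `n`. -/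
def bitCount : ℕ → ℕ → ℕ
  | 0, _ => 0
  | k + 1, n => n % 2 + bitCount k (n / 2)

theorem bitCount_eq_sum (k n : ℕ) : bitCount k n = ∑ i : Fin k, if n.testBit i then 1 else 0 := by
  induction k generalizing n with
  | zero => simp [bitCount]
  | succ k ih =>
    rw [Fin.sum_univ_succ, bitCount, ih]
    simp only [Fin.val_zero, Nat.testBit_zero, Fin.val_succ, Nat.testBit_succ]
    congr 1
    rcases Nat.mod_two_eq_zero_or_one n with h | h <;> simp [h]

theorem hammingNorm_bitVector (n : ℕ) : hammingNorm (bitVector n) = bitCount 23 n := by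
  rw [bitCount_eq_sum, hammingNorm, Finset.card_filter]
  refine Finset.sum_congr rfl fun i _ => ?_
  simp [bitVector]

/-- All sums of subfamilies of a list of bit masks. -/
def xorSpan : List ℕ → List ℕ
  | [] => [0]
  | g :: gs => xorSpan gs ++ (xorSpan gs).map (g ^^^ ·)

theorem mem_span_bitVector_iff (gs : List ℕ) (x : Fin 23 → ZMod 2) :
    x ∈ Submodule.span (ZMod 2) {y | ∃ g ∈ gs, bitVector g = y} ↔
      ∃ n ∈ xorSpan gs, bitVector n = x := by
  induction gs generalizing x with
  | nil => simp [xorSpan, bitVector_zero, eq_comm]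
  | cons g gs ih =>
    have : {y | ∃ h ∈ g :: gs, bitVector h = y}
        = insert (bitVector g) {y | ∃ h ∈ gs, bitVector h = y} := by
      ext y; simp [eq_comm]
    rw [this, Submodule.mem_span_insert]
    simp only [xorSpan, List.mem_append, List.mem_map]
    constructor
    · rintro ⟨a, z, hz, rfl⟩
      obtain ⟨n, hn, rfl⟩ := (ih z).1 hz
      fin_cases a
      · exact ⟨n, Or.inl hn, (zero_add _).symm.trans (congrArg (· + _) (zero_smul _ _).symm)⟩
      · exact ⟨g ^^^ n, Or.inr ⟨n, hn, rfl⟩,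
          (bitVector_xor g n).trans (congrArg (· + _) (one_smul _ _).symm)⟩
    · rintro ⟨m, hm | ⟨n, hn, rfl⟩, rfl⟩
      · exact ⟨0, _, (ih _).2 ⟨m, hm, rfl⟩, by simp⟩
      · exact ⟨1, _, (ih _).2 ⟨n, hn, rfl⟩, by rw [bitVector_xor]; simp⟩

theorem lt_two_pow_of_mem_xorSpan {k : ℕ} {gs : List ℕ} (hgs : ∀ g ∈ gs, g < 2 ^ k) :
    ∀ n ∈ xorSpan gs, n < 2 ^ k := by
  induction gs with
  | nil => simp [xorSpan]
  | cons g gs ih =>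
    have ih' := ih fun h hh => hgs h (List.mem_cons_of_mem _ hh)
    intro n hn
    rcases List.mem_append.1 hn with h | h
    · exact ih' n h
    · obtain ⟨m, hm, rfl⟩ := List.mem_map.1 h
      exact Nat.xor_lt_two_pow (hgs g List.mem_cons_self) (ih' m hm)

/-- Bit masks in echelon form: the lowest digit one of the `i`-th entry is in position `j + i`. -/
def IsBitEchelon : ℕ → List ℕ → Prop
  | _, [] => True
  | j, g :: gs => (g.testBit j = true ∧ ∀ i < j, g.testBit i = false) ∧ IsBitEchelon (j + 1) gs

instance decidableIsBitEchelon : ∀ j gs, Decidable (IsBitEchelon j gs)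
  | _, [] => isTrue trivial
  | j, _ :: gs =>
    @instDecidableAnd _ _ inferInstance (decidableIsBitEchelon (j + 1) gs)

theorem IsBitEchelon.testBit_eq_false {j : ℕ} {gs : List ℕ} (h : IsBitEchelon j gs) :
    ∀ n ∈ xorSpan gs, ∀ i < j, n.testBit i = false := by
  induction gs generalizing j with
  | nil => simp [xorSpan]
  | cons g gs ih =>
    intro n hn i hi
    rcases List.mem_append.1 hn with h' | h'
    · exact ih h.2 n h' i (by omega)
    · obtain ⟨m, hm, rfl⟩ := List.mem_map.1 h'
      rw [Nat.testBit_xor, h.1.2 i hi, ih h.2 m hm i (by omega)]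
      rfl

/-- Bit j is clear on the span of the tail and set after xor with the head, so the two halves are
disjoint. This lets list lengths count codewords. -/
theorem IsBitEchelon.nodup_xorSpan {j : ℕ} {gs : List ℕ} (h : IsBitEchelon j gs) :
    (xorSpan gs).Nodup := by
  induction gs generalizing j with
  | nil => simp [xorSpan]
  | cons g gs ih =>
    refine List.Nodup.append (ih h.2) ((ih h.2).map fun a b hab => Nat.xor_right_injective hab) ?_
    intro n hn hn'
    obtain ⟨m, hm, rfl⟩ := List.mem_map.1 hn'
    have h1 := h.2.testBit_eq_false _ hn j (by omega)
    rw [Nat.testBit_xor, h.1.1, h.2.testBit_eq_false m hm j (by omega)] at h1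
    simp at h1

/-- The remainder of `n` on division by bit masks with lowest digits in positions
`j`, `j + 1`, .... -/
def bitReduce : ℕ → List ℕ → ℕ → ℕ
  | _, [], n => n
  | j, g :: gs, n => bitReduce (j + 1) gs (if n.testBit j then g ^^^ n else n)

theorem mem_xorSpan_of_bitReduce_eq_zero {j n : ℕ} {gs : List ℕ} (h : bitReduce j gs n = 0) :
    n ∈ xorSpan gs := by
  induction gs generalizing j n with
  | nil => simpa [xorSpan, bitReduce] using h
  | cons g gs ih =>
    have h' := ih h
    split_ifs at h'
    · exact List.mem_append_right _ (List.mem_map.2 ⟨_, h', by rw [Nat.xor_xor_cancel_left]⟩)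
    · exact List.mem_append_left _ h'

/-! ### The Golay code and its weights. -/

/-- The bit mask of the `j`-th cyclic shift of the generator of the Golay code. -/
def golayShift (j : ℕ) : ℕ := 2787 * 2 ^ j % (2 ^ 23 - 1)

/-- The bit masks of the words of the Golay code. -/
def golayMasks : List ℕ := xorSpan ((List.range 12).map golayShift)

/-- The binary digits of 2787 are the generator's coefficients, and multiplication by 2 modulo 2²³ -
1 rotates 23 bits. -/
theorem bitVector_golayShift (j : Fin 23) :
    bitVector (golayShift j) = fun i => golayGenerator (i - j) := by
  revert j
  decide +kernel

/-- The first twelve shifts already span the code: reduction against them sends every shift to zero.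
-/
theorem golayShift_mem_golayMasks : ∀ j < 23, golayShift j ∈ golayMasks := by
  have h : ∀ j < 23, bitReduce 0 ((List.range 12).map golayShift) (golayShift j) = 0 := by
    decide +kernel
  exact fun j hj => mem_xorSpan_of_bitReduce_eq_zero (h j hj)

theorem mem_golayCode_iff (x : Fin 23 → ZMod 2) :
    x ∈ golayCode ↔ ∃ n ∈ golayMasks, bitVector n = x := by
  rw [golayMasks, ← mem_span_bitVector_iff]
  suffices h : golayCode = Submodule.span (ZMod 2)
      {y | ∃ g ∈ (List.range 12).map golayShift, bitVector g = y} by rw [h]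
  apply le_antisymm
  · rw [golayCode, Submodule.span_le]
    rintro _ ⟨j, rfl⟩
    exact (mem_span_bitVector_iff _ _).2
      ⟨_, golayShift_mem_golayMasks j j.2, bitVector_golayShift j⟩
  · rw [Submodule.span_le]
    rintro _ ⟨g, hg, rfl⟩
    obtain ⟨j, hj, rfl⟩ := List.mem_map.1 hg
    have hj' : j < 23 := (List.mem_range.1 hj).trans (by norm_num)
    exact Submodule.subset_span ⟨⟨j, hj'⟩, (bitVector_golayShift ⟨j, hj'⟩).symm⟩

/-- The bit masks of the words of weight `7`. -/
def golayMasksSeven : List ℕ := golayMasks.filter fun n => bitCount 23 n == 7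

theorem golayMasks_weights {n : ℕ} (hn : n ∈ golayMasks) :
    bitCount 23 n ∈ [0, 7, 8, 11, 12, 15, 16, 23] := by
  have h : (golayMasks.all fun n =>
      [0, 7, 8, 11, 12, 15, 16, 23].contains (bitCount 23 n)) = true := by
    decide +kernel
  simpa using List.all_eq_true.1 h n hn

theorem golayMasksSeven_length : golayMasksSeven.length = 253 := by
  decide +kernel

theorem golayMasksSeven_nodup : golayMasksSeven.Nodup := by
  have h : IsBitEchelon 0 ((List.range 12).map golayShift) := by decide +kernel
  exact h.nodup_xorSpan.filter _

theorem golayMasksSeven_lt : ∀ n ∈ golayMasksSeven, n < 2 ^ 23 := by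
  have h : ∀ g ∈ (List.range 12).map golayShift, g < 2 ^ 23 := by decide +kernel
  exact fun n hn => lt_two_pow_of_mem_xorSpan h n (List.mem_filter.1 hn).1

/-! ### Johnson distances as intersection sizes, and the upper bound. -/

section JohnsonSpace

open Finset

instance {n w : ℕ} : Finite (JohnsonSpace n w) :=
  inferInstanceAs (Finite {x : Fin n → ZMod 2 // hammingNorm x = w})

/-- The set of coordinates in which a point of the Johnson space has a one. -/
def JohnsonSpace.support {n w : ℕ} (x : JohnsonSpace n w) : Finset (Fin n) :=
  {i | x.1 i ≠ 0}

theorem JohnsonSpace.card_support {n w : ℕ} (x : JohnsonSpace n w) : #x.support = w := x.2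

theorem ZMod.two_eq_of_ne_zero_iff : ∀ {a b : ZMod 2}, (a ≠ 0 ↔ b ≠ 0) → a = b := by
  decide

theorem JohnsonSpace.support_injective {n w : ℕ} :
    Function.Injective (JohnsonSpace.support : JohnsonSpace n w → Finset (Fin n)) := by
  intro x y h
  refine Subtype.ext (funext fun i => ZMod.two_eq_of_ne_zero_iff ?_)
  simpa [JohnsonSpace.support] using Finset.ext_iff.1 h i

theorem JohnsonSpace.hammingDist_add {n w : ℕ} (x y : JohnsonSpace n w) :
    hammingDist x.1 y.1 + 2 * #(x.support ∩ y.support) = 2 * w := by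
  have h : hammingDist x.1 y.1 + 2 * #(x.support ∩ y.support) = #x.support + #y.support := by
    have hc : x.support ∩ y.support = ({i | x.1 i ≠ 0 ∧ y.1 i ≠ 0} : Finset (Fin n)) := by
      ext i; simp [JohnsonSpace.support]
    rw [hc]
    simp only [hammingDist, JohnsonSpace.support, card_filter, mul_sum, ← sum_add_distrib]
    refine sum_congr rfl fun i _ => ?_
    generalize x.1 i = a
    generalize y.1 i = b
    revert a b
    decide
  rw [h, x.card_support, y.card_support]
  ring

theorem johnsonDist_eq {n w : ℕ} (x y : JohnsonSpace n w) :
    johnsonDist x y = w - #(x.support ∩ y.support) := by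
  have h := JohnsonSpace.hammingDist_add x y
  have : (hammingDist x.1 y.1 : ℝ) + 2 * #(x.support ∩ y.support) = 2 * w := by exact_mod_cast h
  rw [johnsonDist]
  linarith

theorem JohnsonSpace.card_inter_lt {n w : ℕ} {x y : JohnsonSpace n w} (h : x ≠ y) :
    #(x.support ∩ y.support) < w := by
  have h1 := JohnsonSpace.hammingDist_add x y
  have h2 : 0 < hammingDist x.1 y.1 := hammingDist_pos.2 fun h' => h (Subtype.ext h')
  omega

theorem ncard_le_of_isSDistanceSet_two {X : Set (JohnsonSpace 24 8)}
    (hX : IsSDistanceSet johnsonDist 2 X) : X.ncard ≤ 253 := by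
  classical
  obtain ⟨hfin, hD⟩ := hX
  obtain ⟨d₁, d₂, hne, hD⟩ := Set.ncard_eq_two.1 hD
  have hmem₁ : d₁ ∈ distanceSet johnsonDist X := by simp [hD]
  have hmem₂ : d₂ ∈ distanceSet johnsonDist X := by simp [hD]
  obtain ⟨x₁, -, y₁, -, hxy₁, rfl⟩ := hmem₁
  obtain ⟨x₂, -, y₂, -, hxy₂, rfl⟩ := hmem₂
  have hpair : ∀ x ∈ X, ∀ y ∈ X, x ≠ y →
      #(x.support ∩ y.support) = #(x₁.support ∩ y₁.support) ∨
      #(x.support ∩ y.support) = #(x₂.support ∩ y₂.support) := by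
    intro x hx y hy hxy
    have hmem : johnsonDist x y ∈ distanceSet johnsonDist X := ⟨x, hx, y, hy, hxy, rfl⟩
    rw [hD] at hmem
    simpa [johnsonDist_eq] using hmem
  have hl : #(x₁.support ∩ y₁.support) ≠ #(x₂.support ∩ y₂.support) := by
    intro h
    exact hne (by rw [johnsonDist_eq, johnsonDist_eq, h])
  have h₁ := JohnsonSpace.card_inter_lt hxy₁
  have h₂ := JohnsonSpace.card_inter_lt hxy₂
  generalize #(x₁.support ∩ y₁.support) = l₁ at *
  generalize #(x₂.support ∩ y₂.support) = l₂ at *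
  let B : Finset (Finset (Fin 24)) := hfin.toFinset.image JohnsonSpace.support
  have hBcard : X.ncard = #B := by
    rw [card_image_of_injective _ JohnsonSpace.support_injective, Set.ncard_eq_toFinset_card X hfin]
  have hk : ∀ s ∈ B, #s = 8 := by
    intro s hs
    obtain ⟨x, -, rfl⟩ := mem_image.1 hs
    exact x.card_support
  have hB : ∀ s ∈ B, ∀ t ∈ B, s ≠ t → #(s ∩ t) = l₁ ∨ #(s ∩ t) = l₂ := by
    intro s hs t ht hst
    obtain ⟨x, hx, rfl⟩ := mem_image.1 hs
    obtain ⟨y, hy, rfl⟩ := mem_image.1 ht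
    exact hpair x (by simpa using hx) y (by simpa using hy) (fun h => hst (by rw [h]))
  rw [hBcard]
  rcases lt_or_gt_of_ne hl with h | h
  · exact card_le_of_two_inter_eight (by simp) h h₂ B hk hB
  · exact card_le_of_two_inter_eight (by simp) h h₁ B hk
      fun s hs t ht hst => (hB s hs t ht hst).symm

/-! ### The Golay words attain the bound. -/

theorem golayWordsOfWeightSeven_ncard : golayWordsOfWeightSeven.ncard = 253 := by
  have hinj : Function.Injective fun u : JohnsonSpace 23 7 => u.1 := fun u v h => Subtype.ext h
  have himage : (fun u : JohnsonSpace 23 7 => u.1) '' golayWordsOfWeightSeven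
      = bitVector '' (golayMasksSeven.toFinset : Set ℕ) := by
    ext x
    simp only [Set.mem_image, List.coe_toFinset, Set.mem_ofPred_eq, golayMasksSeven,
      List.mem_filter, beq_iff_eq]
    constructor
    · rintro ⟨u, hu, rfl⟩
      obtain ⟨n, hn, hnu⟩ := (mem_golayCode_iff _).1 hu
      exact ⟨n, ⟨hn, by rw [← hammingNorm_bitVector, hnu, u.2]⟩, hnu⟩
    · rintro ⟨n, ⟨hn, hw⟩, rfl⟩
      exact ⟨⟨bitVector n, by rw [hammingNorm_bitVector, hw]⟩,
        (mem_golayCode_iff _).2 ⟨n, hn, rfl⟩, rfl⟩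
  rw [← Set.ncard_image_of_injective _ hinj, himage,
    Set.InjOn.ncard_image, Set.ncard_coe_finset,
    List.toFinset_card_of_nodup golayMasksSeven_nodup, golayMasksSeven_length]
  exact bitVector_injOn.mono fun n hn => golayMasksSeven_lt n (by simpa using hn)

theorem prependOne_injective {n w : ℕ} :
    Function.Injective (prependOne : JohnsonSpace n w → JohnsonSpace (n + 1) (w + 1)) := by
  intro u v h
  have h' : (Fin.cons 1 u.1 : Fin (n + 1) → ZMod 2) = Fin.cons 1 v.1 := congrArg Subtype.val h
  exact Subtype.ext (Fin.cons_injective2 h').2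

theorem hammingDist_cons_one {n : ℕ} (u v : Fin n → ZMod 2) :
    hammingDist (Fin.cons 1 u : Fin (n + 1) → ZMod 2) (Fin.cons 1 v : Fin (n + 1) → ZMod 2)
      = hammingDist u v := by
  simp only [hammingDist, card_filter]
  rw [Fin.sum_univ_succ]
  simp

theorem johnsonDist_prependOne {n w : ℕ} (u v : JohnsonSpace n w) :
    johnsonDist (prependOne u) (prependOne v) = johnsonDist u v := by
  rw [johnsonDist, johnsonDist, ← hammingDist_cons_one u.1 v.1]
  rfl

theorem hammingDist_eq_hammingNorm_add {n : ℕ} (x y : Fin n → ZMod 2) :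
    hammingDist x y = hammingNorm (x + y) := by
  rw [hammingDist_eq_hammingNorm, ZModModule.neg_eq_self]

/-- The distance is a code weight that is positive, even and at most 14. -/
theorem hammingDist_of_mem_golayWordsOfWeightSeven {u v : JohnsonSpace 23 7}
    (hu : u ∈ golayWordsOfWeightSeven) (hv : v ∈ golayWordsOfWeightSeven) (huv : u ≠ v) :
    hammingDist u.1 v.1 = 8 ∨ hammingDist u.1 v.1 = 12 := by
  obtain ⟨n, hn, hnu⟩ := (mem_golayCode_iff _).1 (golayCode.add_mem hu hv)
  have hw := golayMasks_weights hn
  rw [← hammingNorm_bitVector, hnu, ← hammingDist_eq_hammingNorm_add] at hw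
  have h1 := JohnsonSpace.hammingDist_add u v
  have h2 : 0 < hammingDist u.1 v.1 := hammingDist_pos.2 fun h' => huv (Subtype.ext h')
  simp only [List.mem_cons, List.not_mem_nil, or_false] at hw
  omega

theorem golayShift_weight : ∀ j < 23, bitCount 23 (golayShift j) = 7 := by
  decide +kernel

/-- The `j`-th cyclic shift of the generator of the Golay code. -/
def golayShiftWord (j : Fin 23) : JohnsonSpace 23 7 :=
  ⟨bitVector (golayShift j), by rw [hammingNorm_bitVector, golayShift_weight j j.2]⟩

theorem golayShiftWord_mem (j : Fin 23) : golayShiftWord j ∈ golayWordsOfWeightSeven :=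
  (mem_golayCode_iff _).2 ⟨_, golayShift_mem_golayMasks j j.2, rfl⟩

theorem johnsonDist_golayShiftWord (i j : Fin 23) :
    johnsonDist (golayShiftWord i) (golayShiftWord j)
      = (bitCount 23 (golayShift i ^^^ golayShift j) : ℝ) / 2 := by
  rw [johnsonDist, ← hammingNorm_bitVector, bitVector_xor, ← hammingDist_eq_hammingNorm_add]
  rfl

theorem isSDistanceSet_prependOne_golay :
    IsSDistanceSet (johnsonDist (n := 24) (w := 8)) 2
      (prependOne '' golayWordsOfWeightSeven) := by
  refine ⟨Set.toFinite _, ?_⟩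
  rw [Set.ncard_eq_two]
  refine ⟨4, 6, by norm_num, Set.Subset.antisymm ?_ ?_⟩
  · rintro _ ⟨_, ⟨u, hu, rfl⟩, _, ⟨v, hv, rfl⟩, hne, rfl⟩
    have huv : u ≠ v := fun h => hne (by rw [h])
    rw [johnsonDist_prependOne, johnsonDist]
    rcases hammingDist_of_mem_golayWordsOfWeightSeven hu hv huv with h | h <;> rw [h] <;> norm_num
  · have key : ∀ i j : Fin 23, ∀ d : ℕ, bitCount 23 (golayShift i ^^^ golayShift j) = 2 * d →
        0 < d → (d : ℝ) ∈ distanceSet johnsonDist (prependOne '' golayWordsOfWeightSeven) := by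
      intro i j d h hd
      have hdist : johnsonDist (golayShiftWord i) (golayShiftWord j) = d := by
        rw [johnsonDist_golayShiftWord, h]; push_cast; ring
      refine ⟨_, ⟨_, golayShiftWord_mem i, rfl⟩, _, ⟨_, golayShiftWord_mem j, rfl⟩, ?_, ?_⟩
      · intro hij
        rw [prependOne_injective hij, johnsonDist, hammingDist_self] at hdist
        have : (d : ℝ) ≠ 0 := by exact_mod_cast hd.ne'
        simp at hdist
        exact this hdist.symm
      · rw [johnsonDist_prependOne, hdist]
    rintro _ (rfl | rfl)
    -- Shifts 0 and 1 differ in 8 places, shifts 0 and 3 in 12, so both distances occur.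
    · exact_mod_cast key 0 1 4 (by decide +kernel) (by norm_num)
    · exact_mod_cast key 0 3 6 (by decide +kernel) (by norm_num)

end JohnsonSpace

theorem mainTheorem7 :
    IsMaxSDistanceCard (johnsonDist (n := 24) (w := 8)) 2 253 ∧
    golayWordsOfWeightSeven.ncard = 253 ∧
    IsSDistanceSet (johnsonDist (n := 24) (w := 8)) 2 (prependOne '' golayWordsOfWeightSeven) ∧
    (prependOne '' golayWordsOfWeightSeven).ncard = 253 := by
  have hcard : (prependOne '' golayWordsOfWeightSeven).ncard = 253 := by
    rw [Set.ncard_image_of_injective _ prependOne_injective, golayWordsOfWeightSeven_ncard]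
  refine ⟨⟨⟨_, isSDistanceSet_prependOne_golay, hcard⟩, ?_⟩, golayWordsOfWeightSeven_ncard,
    isSDistanceSet_prependOne_golay, hcard⟩
  rintro _ ⟨X, hX, rfl⟩
  exact ncard_le_of_isSDistanceSet_two hX
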